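/- A pattern is a subset $P\subseteq\mathbb{N}\times\mathbb{N}$. For a complex matrix $X=[x_{ij}]_{i,j\in\mathbb{N}}$ let $S_X$ be the Schur multiplier $S_X([t_{ij}])=[x_{ij}t_{ij}]$ on $\mathcal{B}(\ell^2(\mathbb{N}))$, and let $\|X\|_m$ be its operator norm ($\infty$ if $S_X$ is not a bounded operator on $\mathcal{B}(\ell^2(\mathbb{N}))$). Let $\mathcal{S}(P)$ be the set of complex matrices $X$ with $|x_{ij}|\le 1$ for all $i,j$ and $x_{ij}=0$ for $(i,j)\notin P$. Call $P$ Schur bounded if $S_X$ is bounded for every $X\in\mathcal{S}(P)$, and put $\mathfrak{s}(P)=\sup_{X\in\mathcal{S}(P)}\|X\|_m$. Call a pattern row bounded (column bounded) by $k\in\mathbb{N}=\{0,1,2,\dots\}$ if it has at most $k$ entries in each row (column), and row finite (column finite) if it is row bounded (column bounded) by some $k$. **Theorem.** For a pattern $P\subseteq\mathbb{N}\times\mathbb{N}$ the following are equivalent: 1. $P$ is Schur bounded. 2. $P$ is the union of a row finite set and a column finite set. 3. $\displaystyle\sup_{R,C}\frac{|P\cap(R\times C)|}{|R|+|C|}<\infty$,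 the supremum being over finite sets $R,C\subset\mathbb{N}$, not both empty. Moreover, if these conditions hold, the least integer $m\ge 0$ such that $P$ is the union of a set row bounded by $m$ and a set column bounded by $m$ coincides with the least integer dominating the supremum in (3), and $$\frac{\sqrt m}{4}\le\mathfrak{s}(P)\le 2\sqrt m .$$ -/

import Mathlib

open scoped ENNReal

namespace SchurPattern

/-- The Hilbert space `ℓ²(ℕ)` over the complex numbers. -/
abbrev Ell2 : Type := lp (fun _ : ℕ => ℂ) 2

/-- The `(i, j)` matrix entry `⟨T e_j, e_i⟩` of a bounded operator `T` on `ℓ²(ℕ)`. -/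
noncomputable def entry (T : Ell2 →L[ℂ] Ell2) (i j : ℕ) : ℂ :=
  (T (lp.single 2 j (1 : ℂ)) : Ell2) i

/-- `Φ` is the Schur multiplier `S_A` as a bounded operator on `B(ℓ²(ℕ))`: it multiplies the
matrix of every `T` entrywise by `A`. There is at most one such `Φ`, see
`IsSchurMultiplier.unique`. -/
def IsSchurMultiplier (A : Matrix ℕ ℕ ℂ)
    (Φ : (Ell2 →L[ℂ] Ell2) →L[ℂ] (Ell2 →L[ℂ] Ell2)) : Prop :=
  ∀ (T : Ell2 →L[ℂ] Ell2) (i j : ℕ), entry (Φ T) i j = A i j * entry T i j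

/-- `A` yields a bounded Schur multiplier on `B(ℓ²(ℕ))`. -/
def IsBoundedSchurMultiplier (A : Matrix ℕ ℕ ℂ) : Prop :=
  ∃ Φ : (Ell2 →L[ℂ] Ell2) →L[ℂ] (Ell2 →L[ℂ] Ell2), IsSchurMultiplier A Φ

/-- The Schur multiplier norm `‖A‖_m`: the operator norm of `S_A` on `B(ℓ²(ℕ))` if `S_A` is a
bounded operator there (then the infimum is over one element, see `schurNorm_eq`), and `∞`
otherwise. -/
noncomputable def schurNorm (A : Matrix ℕ ℕ ℂ) : ℝ≥0∞ :=
  ⨅ (Φ : (Ell2 →L[ℂ] Ell2) →L[ℂ] (Ell2 →L[ℂ] Ell2)) (_ : IsSchurMultiplier A Φ), ‖Φ‖ₑ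

/-- The matrices supported on the pattern `P` all of whose entries have modulus at most one. -/
def supportedMatrices (P : Set (ℕ × ℕ)) : Set (Matrix ℕ ℕ ℂ) :=
  {X | (∀ i j, X i j ≠ 0 → (i, j) ∈ P) ∧ ∀ i j, ‖X i j‖ ≤ 1}

/-- A pattern is Schur bounded if every matrix supported on it with entries of modulus at most
one yields a bounded Schur multiplier. -/
def SchurBounded (P : Set (ℕ × ℕ)) : Prop :=
  ∀ X ∈ supportedMatrices P, IsBoundedSchurMultiplier X

/-- The Schur bound `𝔰(P)` of a pattern. -/
noncomputable def schurBound (P : Set (ℕ × ℕ)) : ℝ≥0∞ :=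
  ⨆ X ∈ supportedMatrices P, schurNorm X

/-- There are at most `k` entries of `Q` in each row. -/
def RowBounded (Q : Set (ℕ × ℕ)) (k : ℕ) : Prop :=
  ∀ i, {j | (i, j) ∈ Q}.encard ≤ k

/-- There are at most `k` entries of `Q` in each column. -/
def ColumnBounded (Q : Set (ℕ × ℕ)) (k : ℕ) : Prop :=
  ∀ j, {i | (i, j) ∈ Q}.encard ≤ k

/-- Row finite means row bounded by some uniform `k`. -/
def RowFinite (Q : Set (ℕ × ℕ)) : Prop := ∃ k, RowBounded Q k

/-- Column finite means column bounded by some uniform `k`. -/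
def ColumnFinite (Q : Set (ℕ × ℕ)) : Prop := ∃ k, ColumnBounded Q k

/-- The supremum of `|P ∩ (R × C)| / (|R| + |C|)` over finite `R, C ⊆ ℕ`, as an extended
nonnegative real. The pair `R = C = ∅` contributes `0 / 0 = 0`, which does not affect it. -/
noncomputable def density (P : Set (ℕ × ℕ)) : ℝ≥0∞ :=
  ⨆ (R : Finset ℕ) (C : Finset ℕ),
    ((P ∩ ((R : Set ℕ) ×ˢ (C : Set ℕ))).ncard : ℝ≥0∞) / ((R.card : ℝ≥0∞) + (C.card : ℝ≥0∞))

theorem entry_ext {S T : Ell2 →L[ℂ] Ell2} (h : ∀ i j, entry S i j = entry T i j) : S = T := by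
  refine ContinuousLinearMap.ext fun x => ?_
  have hx := lp.hasSum_single (p := 2) ENNReal.ofNat_ne_top x
  refine (hx.mapL S).unique ?_
  convert hx.mapL T using 2 with j
  have hs : (lp.single 2 j (x j) : Ell2) = x j • (lp.single 2 j (1 : ℂ) : Ell2) := by
    rw [← lp.single_smul, smul_eq_mul, mul_one]
  rw [hs, map_smul, map_smul]
  congr 1
  exact lp.ext (funext fun i => h i j)

theorem IsSchurMultiplier.unique {A : Matrix ℕ ℕ ℂ}
    {Φ Ψ : (Ell2 →L[ℂ] Ell2) →L[ℂ] (Ell2 →L[ℂ] Ell2)}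
    (hΦ : IsSchurMultiplier A Φ) (hΨ : IsSchurMultiplier A Ψ) : Φ = Ψ :=
  ContinuousLinearMap.ext fun T => entry_ext fun i j => (hΦ T i j).trans (hΨ T i j).symm

theorem schurNorm_eq {A : Matrix ℕ ℕ ℂ}
    {Φ : (Ell2 →L[ℂ] Ell2) →L[ℂ] (Ell2 →L[ℂ] Ell2)}
    (hΦ : IsSchurMultiplier A Φ) : schurNorm A = ‖Φ‖ₑ := by
  refine le_antisymm (iInf₂_le Φ hΦ) (le_iInf₂ fun Ψ hΨ => ?_)
  rw [hΦ.unique hΨ]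

end SchurPattern

/-! The equivalence of (2) and (3), with the same optimal integer, is Hall's theorem. Give every row
and every column `k` slots and let each entry of `P` choose a slot of its row or of its column; the
Hall condition is the bound `k * (|R| + |C|)` on the entries in each finite rectangle
(`exists_decomposition_iff_density_le`).

A row bounded pattern has Schur bound at most `√k` by Cauchy–Schwarz and the fact that the columns
of `T` have norm at most `‖T‖`. Taking adjoints gives the column bounded case, and adding the two
gives `2√k`.

For the lower bound, a rectangle holding more than `k * (|R| + |C|)` entries is pruned until all its
rows and columns hold at least `m = k + 1`. By transposing, it has at least as many columns as rows;
keep exactly `m` entries in each column. Averaging over signs yields a signed matrix `S` for which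
`Z = D^(-1/2) S`, with `D` a diagonal of truncated row sums, has a small quartic sum. The
contraction `√2 Z (1 + ZᵀZ / 2)⁻¹` then pairs with `S` to at least `√m / 2`, which is better than
the required `√m / 4`.

Schur boundedness assumes no uniform estimate. The closed graph theorem on `ℓ^∞(P)` supplies one,
and with the lower bound it forces finite density. -/

namespace SchurPattern

/-! ### Rectangle counts, Hall's theorem and pruning -/

open scoped Classical in
/-- The number of entries of `P` in the rectangle `R × C`. -/
noncomputable def rectCount (P : Set (ℕ × ℕ)) (R C : Finset ℕ) : ℕ :=
  ((R ×ˢ C).filter (· ∈ P)).card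

open scoped Classical in
theorem ncard_inter_eq_rectCount (P : Set (ℕ × ℕ)) (R C : Finset ℕ) :
    (P ∩ ((R : Set ℕ) ×ˢ (C : Set ℕ))).ncard = rectCount P R C := by
  rw [rectCount, ← Set.ncard_coe_finset]
  congr 1
  ext x
  simp [and_comm]

open scoped Classical in
theorem rectCount_eq_sum_rows (P : Set (ℕ × ℕ)) (R C : Finset ℕ) :
    rectCount P R C = ∑ i ∈ R, (C.filter fun j => (i, j) ∈ P).card := by
  simp only [rectCount, Finset.card_filter, Finset.sum_product]

open scoped Classical in
theorem rectCount_eq_sum_columns (P : Set (ℕ × ℕ)) (R C : Finset ℕ) :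
    rectCount P R C = ∑ j ∈ C, (R.filter fun i => (i, j) ∈ P).card := by
  simp only [rectCount, Finset.card_filter, Finset.sum_product_right]

theorem density_le_natCast_iff (P : Set (ℕ × ℕ)) (k : ℕ) :
    density P ≤ (k : ℝ≥0∞) ↔ ∀ R C : Finset ℕ, rectCount P R C ≤ k * (R.card + C.card) := by
  simp only [density, iSup_le_iff, ncard_inter_eq_rectCount]
  refine forall₂_congr fun R C => ?_
  rw [ENNReal.div_le_iff_le_mul (Or.inr (by simp)) (Or.inl (by simp))]
  exact_mod_cast Iff.rfl

theorem card_filter_le_of_encard_le {Q : Set ℕ} {k : ℕ} (h : Q.encard ≤ k) (C : Finset ℕ)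
    [DecidablePred (· ∈ Q)] : (C.filter (· ∈ Q)).card ≤ k := by
  have h1 : ((C.filter (· ∈ Q) : Finset ℕ) : Set ℕ).encard ≤ Q.encard :=
    Set.encard_le_encard fun x hx => by simpa using (Finset.mem_filter.1 hx).2
  rw [Set.encard_coe_eq_coe_finsetCard] at h1
  exact_mod_cast h1.trans h

theorem rectCount_le_of_rowBounded_union_columnBounded {Pr Pc : Set (ℕ × ℕ)} {k : ℕ}
    (hr : RowBounded Pr k) (hc : ColumnBounded Pc k) (R C : Finset ℕ) :
    rectCount (Pr ∪ Pc) R C ≤ k * (R.card + C.card) := by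
  classical
  have h1 : rectCount (Pr ∪ Pc) R C ≤ rectCount Pr R C + rectCount Pc R C := by
    refine le_trans (Finset.card_le_card ?_) (Finset.card_union_le _ _)
    intro x hx
    simp only [Finset.mem_filter, Finset.mem_union, Set.mem_union] at hx ⊢
    tauto
  have h2 : rectCount Pr R C ≤ R.card * k := by
    rw [rectCount_eq_sum_rows]
    exact Finset.sum_le_card_nsmul _ _ _ fun i _ =>
      card_filter_le_of_encard_le (hr i) C
  have h3 : rectCount Pc R C ≤ C.card * k := by
    rw [rectCount_eq_sum_columns]
    exact Finset.sum_le_card_nsmul _ _ _ fun j _ =>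
      card_filter_le_of_encard_le (hc j) R
  linarith

/-- Each entry of `P` can be charged to one of `k` slots of its row or of its column, by Hall's
marriage theorem. -/
theorem exists_rowBounded_union_columnBounded {P : Set (ℕ × ℕ)} {k : ℕ}
    (h : ∀ R C : Finset ℕ, rectCount P R C ≤ k * (R.card + C.card)) :
    ∃ Pr Pc : Set (ℕ × ℕ), RowBounded Pr k ∧ ColumnBounded Pc k ∧ P = Pr ∪ Pc := by
  classical
  let t : P → Finset ((ℕ ⊕ ℕ) × Fin k) := fun e =>
    ({Sum.inl e.1.1, Sum.inr e.1.2} : Finset (ℕ ⊕ ℕ)) ×ˢ Finset.univ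
  have hall : ∀ s : Finset P, s.card ≤ (s.biUnion t).card := by
    intro s
    set R := s.image fun e => e.1.1
    set C := s.image fun e => e.1.2
    have h1 : s.card ≤ rectCount P R C := by
      rw [rectCount, ← Finset.card_map (Function.Embedding.subtype _)]
      refine Finset.card_le_card fun x hx => ?_
      obtain ⟨e, he, rfl⟩ := Finset.mem_map.1 hx
      exact Finset.mem_filter.2 ⟨Finset.mem_product.2
        ⟨Finset.mem_image_of_mem (fun e : P => e.1.1) he,
          Finset.mem_image_of_mem (fun e : P => e.1.2) he⟩, e.2⟩
    have h2 : (R.disjSum C) ×ˢ (Finset.univ : Finset (Fin k)) ⊆ s.biUnion t := by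
      rintro ⟨v, l⟩ hv
      simp only [Finset.mem_product, Finset.mem_univ, and_true, Finset.mem_disjSum] at hv
      simp only [Finset.mem_biUnion, t, Finset.mem_product, Finset.mem_insert,
        Finset.mem_singleton, Finset.mem_univ, and_true]
      rcases hv with ⟨a, ha, rfl⟩ | ⟨a, ha, rfl⟩
      · obtain ⟨e, he, rfl⟩ := Finset.mem_image.1 ha
        exact ⟨e, he, Or.inl rfl⟩
      · obtain ⟨e, he, rfl⟩ := Finset.mem_image.1 ha
        exact ⟨e, he, Or.inr rfl⟩
    have h3 := Finset.card_le_card h2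
    rw [Finset.card_product, Finset.card_disjSum, Finset.card_univ, Fintype.card_fin] at h3
    have := h R C
    linarith
  -- `P` may be infinite: this form of Hall's theorem only needs each set of admissible slots to be
  -- finite.
  obtain ⟨f, hf, hft⟩ := (Finset.all_card_le_biUnion_card_iff_exists_injective t).1 hall
  refine ⟨{e | ∃ he : e ∈ P, (f ⟨e, he⟩).1 = Sum.inl e.1},
    {e | ∃ he : e ∈ P, (f ⟨e, he⟩).1 = Sum.inr e.2}, fun i => ?_, fun j => ?_, ?_⟩
  · have := ENat.card_le_card_of_injective
      (α := {j | (i, j) ∈ {e : ℕ × ℕ | ∃ he : e ∈ P, (f ⟨e, he⟩).1 = Sum.inl e.1}})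
      (β := Fin k) (f := fun j => (f ⟨(i, j.1), j.2.1⟩).2) (by
        rintro ⟨a, ha, ha'⟩ ⟨b, hb, hb'⟩ hab
        have := hf (Prod.ext (ha'.trans hb'.symm) hab)
        simpa using this)
    exact this.trans (by simp)
  · have := ENat.card_le_card_of_injective
      (α := {i | (i, j) ∈ {e : ℕ × ℕ | ∃ he : e ∈ P, (f ⟨e, he⟩).1 = Sum.inr e.2}})
      (β := Fin k) (f := fun i => (f ⟨(i.1, j), i.2.1⟩).2) (by
        rintro ⟨a, ha, ha'⟩ ⟨b, hb, hb'⟩ hab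
        have := hf (Prod.ext (ha'.trans hb'.symm) hab)
        simpa using this)
    exact this.trans (by simp)
  · ext e
    constructor
    · intro he
      have := hft ⟨e, he⟩
      simp only [t, Finset.mem_product, Finset.mem_insert, Finset.mem_singleton,
        Finset.mem_univ, and_true] at this
      exact this.imp (fun h => ⟨he, h⟩) fun h => ⟨he, h⟩
    · rintro (⟨he, -⟩ | ⟨he, -⟩) <;> exact he

theorem exists_decomposition_iff_density_le (P : Set (ℕ × ℕ)) (k : ℕ) :
    (∃ Pr Pc : Set (ℕ × ℕ), RowBounded Pr k ∧ ColumnBounded Pc k ∧ P = Pr ∪ Pc) ↔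
      density P ≤ (k : ℝ≥0∞) := by
  rw [density_le_natCast_iff]
  refine ⟨?_, exists_rowBounded_union_columnBounded⟩
  rintro ⟨Pr, Pc, hr, hc, rfl⟩
  exact rectCount_le_of_rowBounded_union_columnBounded hr hc

open scoped Classical in
/-- A rectangle in which `P` is dense contains one in which every row and every column has many
entries of `P`. -/
theorem exists_min_degree {P : Set (ℕ × ℕ)} {k : ℕ} (R C : Finset ℕ)
    (h : k * (R.card + C.card) < rectCount P R C) :
    ∃ R' C' : Finset ℕ, R'.Nonempty ∧ C'.Nonempty ∧
      (∀ i ∈ R', k < (C'.filter fun j => (i, j) ∈ P).card) ∧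
      ∀ j ∈ C', k < (R'.filter fun i => (i, j) ∈ P).card := by
  induction hn : R.card + C.card using Nat.strong_induction_on generalizing R C with
  | _ n ih =>
    by_cases hR : ∃ i ∈ R, (C.filter fun j => (i, j) ∈ P).card ≤ k
    · obtain ⟨i, hi, hik⟩ := hR
      have hcard := Finset.card_erase_add_one hi
      refine ih _ (by omega) (R.erase i) C ?_ rfl
      rw [rectCount_eq_sum_rows, ← Finset.add_sum_erase _ _ hi] at h
      rw [rectCount_eq_sum_rows]
      have : k * (R.card + C.card) = k * ((R.erase i).card + C.card) + k := by
        rw [← hcard]; ring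
      omega
    by_cases hC : ∃ j ∈ C, (R.filter fun i => (i, j) ∈ P).card ≤ k
    · obtain ⟨j, hj, hjk⟩ := hC
      have hcard := Finset.card_erase_add_one hj
      refine ih _ (by omega) R (C.erase j) ?_ rfl
      rw [rectCount_eq_sum_columns, ← Finset.add_sum_erase _ _ hj] at h
      rw [rectCount_eq_sum_columns]
      have : k * (R.card + C.card) = k * (R.card + (C.erase j).card) + k := by
        rw [← hcard]; ring
      omega
    push Not at hR hC
    have hne : (R ×ˢ C).Nonempty := by
      rw [Finset.nonempty_iff_ne_empty]
      intro h0
      simp [rectCount, h0] at h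
    exact ⟨R, C, hne.fst, hne.snd, hR, hC⟩

end SchurPattern

namespace SchurPattern

/-! ### Real contractions and the damped matrix -/

section Finite

variable {ι κ : Type*} [Fintype ι] [Fintype κ]

open Matrix

/-- A real matrix is a contraction if its bilinear form is bounded by the Euclidean norms. -/
def IsContractive (T : Matrix ι κ ℝ) : Prop :=
  ∀ (u : ι → ℝ) (v : κ → ℝ), (u ⬝ᵥ T *ᵥ v) ^ 2 ≤ (u ⬝ᵥ u) * (v ⬝ᵥ v)

theorem dotProduct_sq_le (u v : ι → ℝ) : (u ⬝ᵥ v) ^ 2 ≤ (u ⬝ᵥ u) * (v ⬝ᵥ v) := by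
  simpa only [dotProduct, sq] using Finset.sum_mul_sq_le_sq_mul_sq Finset.univ u v

theorem dotProduct_self_nonneg' (u : ι → ℝ) : 0 ≤ u ⬝ᵥ u :=
  Finset.sum_nonneg fun _ _ => mul_self_nonneg _

theorem IsContractive.of_mulVec {T : Matrix ι κ ℝ}
    (h : ∀ v, (T *ᵥ v) ⬝ᵥ (T *ᵥ v) ≤ v ⬝ᵥ v) : IsContractive T := fun u v =>
  (dotProduct_sq_le u _).trans (mul_le_mul_of_nonneg_left (h v) (dotProduct_self_nonneg' u))

theorem IsContractive.transpose {T : Matrix ι κ ℝ} (h : IsContractive T) :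
    IsContractive Tᵀ := fun u v => by
  have := h v u
  rwa [dotProduct_mulVec, ← mulVec_transpose, dotProduct_comm, mul_comm] at this

theorem dotProduct_transpose_mul_self (Z : Matrix ι κ ℝ) (u v : κ → ℝ) :
    u ⬝ᵥ (Zᵀ * Z) *ᵥ v = (Z *ᵥ u) ⬝ᵥ (Z *ᵥ v) := by
  rw [← mulVec_mulVec, dotProduct_mulVec, vecMul_transpose]

section Resolvent

variable [DecidableEq κ]

theorem isUnit_one_add_half_transpose_mul_self (Z : Matrix ι κ ℝ) :
    IsUnit (1 + (1 / 2 : ℝ) • (Zᵀ * Z)) := by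
  rw [← mulVec_injective_iff_isUnit]
  refine (injective_iff_map_eq_zero (mulVecLin (1 + (1 / 2 : ℝ) • (Zᵀ * Z)))).2 fun v hv => ?_
  rw [mulVecLin_apply, add_mulVec, one_mulVec, smul_mulVec] at hv
  have h1 : v ⬝ᵥ v + (1 / 2) * ((Z *ᵥ v) ⬝ᵥ (Z *ᵥ v)) = 0 := by
    rw [← dotProduct_transpose_mul_self, ← smul_eq_mul, ← dotProduct_smul, ← dotProduct_add, hv,
      dotProduct_zero]
  have h2 := dotProduct_self_nonneg' (Z *ᵥ v)
  have h3 := dotProduct_self_nonneg' v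
  exact dotProduct_self_eq_zero.1 (by linarith)

/-- The damped matrix `√2 Z (1 + ZᵀZ / 2)⁻¹` is a contraction. -/
theorem isContractive_damped (Z : Matrix ι κ ℝ) :
    IsContractive (√2 • (Z * (1 + (1 / 2 : ℝ) • (Zᵀ * Z))⁻¹)) := by
  refine IsContractive.of_mulVec fun x => ?_
  set B := 1 + (1 / 2 : ℝ) • (Zᵀ * Z) with hB
  set y := B⁻¹ *ᵥ x with hy
  have hx : x = y + (1 / 2 : ℝ) • ((Zᵀ * Z) *ᵥ y) := by
    have : B *ᵥ y = x := by
      rw [hy, mulVec_mulVec, mul_nonsing_inv _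
        ((isUnit_iff_isUnit_det _).1 (isUnit_one_add_half_transpose_mul_self Z)), one_mulVec]
    rw [← this, hB, add_mulVec, one_mulVec, smul_mulVec]
  rw [smul_mulVec, ← mulVec_mulVec, ← hy, dotProduct_smul, smul_dotProduct, smul_smul,
    smul_eq_mul, Real.mul_self_sqrt zero_le_two, ← dotProduct_transpose_mul_self, hx]
  set w := (Zᵀ * Z) *ᵥ y
  -- With `x = y + w / 2` the claim is `2 y·w ≤ |y + w / 2|²`, and the difference of the two sides
  -- is this square.
  have h0 := dotProduct_self_nonneg' (y - (1 / 2 : ℝ) • w)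
  simp only [dotProduct_add, add_dotProduct, dotProduct_sub, sub_dotProduct, dotProduct_smul,
    smul_dotProduct, smul_eq_mul, dotProduct_comm w y] at h0 ⊢
  linarith

/-- Operator form of the tangent line bound `1 / (1 + t / 2) ≥ 3 / 4 - t / 8` at `t = 2`, the value
matching the factor `2` in the quartic estimate. -/
theorem dotProduct_resolvent_ge (Z : Matrix ι κ ℝ) (s : κ → ℝ) :
    (3 / 4) * (s ⬝ᵥ s) - (1 / 8) * ((Z *ᵥ s) ⬝ᵥ (Z *ᵥ s)) ≤
      s ⬝ᵥ (1 + (1 / 2 : ℝ) • (Zᵀ * Z))⁻¹ *ᵥ s := by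
  set B := 1 + (1 / 2 : ℝ) • (Zᵀ * Z) with hB
  set y := B⁻¹ *ᵥ s with hy
  have hs : s = y + (1 / 2 : ℝ) • ((Zᵀ * Z) *ᵥ y) := by
    have : B *ᵥ y = s := by
      rw [hy, mulVec_mulVec, mul_nonsing_inv _
        ((isUnit_iff_isUnit_det _).1 (isUnit_one_add_half_transpose_mul_self Z)), one_mulVec]
    rw [← this, hB, add_mulVec, one_mulVec, smul_mulVec]
  have e1 : ∀ u, u ⬝ᵥ s = u ⬝ᵥ y + (1 / 2) * ((Z *ᵥ u) ⬝ᵥ (Z *ᵥ y)) := fun u => by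
    conv_lhs => rw [hs]
    rw [dotProduct_add, dotProduct_smul, dotProduct_transpose_mul_self, smul_eq_mul]
  -- `h1` plus half of `h2` says that the quadratic form of `B` is nonnegative at `y - s / 2`; since
  -- `B y = s`, this is the claim.
  have h1 := dotProduct_self_nonneg' (y - (1 / 2 : ℝ) • s)
  have h2 := dotProduct_self_nonneg' (Z *ᵥ (y - (1 / 2 : ℝ) • s))
  have hys := e1 y
  have hss := e1 s
  rw [dotProduct_comm y s] at hys
  simp only [mulVec_sub, mulVec_smul, dotProduct_sub, sub_dotProduct, dotProduct_smul,
    smul_dotProduct, smul_eq_mul, dotProduct_comm (Z *ᵥ y) (Z *ᵥ s), dotProduct_comm y s]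
    at h1 h2 hys hss
  linarith

end Resolvent

/-- If the quartic sum of a matrix is controlled by its number of entries, then its pairing with
a suitable contraction is large. -/
theorem exists_isContractive_pairing_ge (S : Matrix ι κ ℝ) (D : ι → ℝ) (hD : ∀ i, 0 < D i)
    (hQ : ∑ i, ∑ k, (D k)⁻¹ * (∑ j, S k j * S i j) ^ 2 ≤ 2 * ∑ i, ∑ j, S i j ^ 2) :
    ∃ T : Matrix ι κ ℝ, IsContractive T ∧
      √2 / 2 * ∑ i, ∑ j, S i j ^ 2 ≤ ∑ i, ∑ j, S i j * T i j * √(D i) := by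
  classical
  set Z : Matrix ι κ ℝ := Matrix.of fun i j => S i j / √(D i) with hZ
  set G := (1 + (1 / 2 : ℝ) • (Zᵀ * Z))⁻¹ with hG
  have hsq : ∀ i, √(D i) ≠ 0 := fun i => (Real.sqrt_pos.2 (hD i)).ne'
  refine ⟨√2 • (Z * G), isContractive_damped Z, ?_⟩
  have hsymm : Gᵀ = G := by
    rw [hG, transpose_nonsing_inv, transpose_add, transpose_one, transpose_smul, transpose_mul,
      transpose_transpose]
  have e1 : ∀ i j, S i j * (√2 • (Z * G)) i j * √(D i) = √2 * (S i j * (G *ᵥ S i) j) := by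
    intro i j
    have : (Z * G) i j * √(D i) = (G *ᵥ S i) j := by
      conv_rhs => rw [← hsymm]
      rw [mul_apply, mulVec, dotProduct, Finset.sum_mul]
      refine Finset.sum_congr rfl fun l _ => ?_
      simp only [hZ, of_apply, transpose_apply]
      field_simp [hsq i]
    rw [← this, Matrix.smul_apply, smul_eq_mul]
    ring
  have e2 : ∀ i, ∑ j, S i j ^ 2 = S i ⬝ᵥ S i := fun i => by simp only [dotProduct, sq]
  have e3 : ∀ i, ∑ k, (D k)⁻¹ * (∑ j, S k j * S i j) ^ 2 = (Z *ᵥ S i) ⬝ᵥ (Z *ᵥ S i) := by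
    intro i
    refine Finset.sum_congr rfl fun k _ => ?_
    have : (Z *ᵥ S i) k = (∑ j, S k j * S i j) / √(D k) := by
      rw [mulVec, dotProduct, Finset.sum_div]
      refine Finset.sum_congr rfl fun l _ => ?_
      simp only [hZ, of_apply]
      ring
    rw [this, ← sq, div_pow, Real.sq_sqrt (hD k).le]
    ring
  simp only [e1, e2, e3, ← Finset.mul_sum] at hQ ⊢
  have h := Finset.sum_le_sum fun i (_ : i ∈ Finset.univ) => dotProduct_resolvent_ge Z (S i)
  rw [Finset.sum_sub_distrib, ← Finset.mul_sum, ← Finset.mul_sum] at h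
  have h' : (1 / 2) * ∑ i, S i ⬝ᵥ S i ≤ ∑ i, ∑ j, S i j * (G *ᵥ S i) j := by
    have : ∑ i, ∑ j, S i j * (G *ᵥ S i) j = ∑ i, S i ⬝ᵥ G *ᵥ S i := rfl
    rw [this]
    linarith
  have := mul_le_mul_of_nonneg_left h' (Real.sqrt_nonneg 2)
  linarith

end Finite

end SchurPattern

namespace SchurPattern

/-! ### Averaging over signs -/

section Signs

variable {ι κ : Type*} [Fintype ι] [Fintype κ] [DecidableEq ι] [DecidableEq κ]

/-- The product of the signs at the corners of a rectangle has mean zero unless the rectangle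
degenerates. A single point is counted twice on the right, which only weakens the bound. -/
theorem sum_signs_rectangle_le (i k : ι) (j l : κ) :
    ∑ ε : ι × κ → ℤˣ, ((ε (k, j) * ε (i, j) * (ε (k, l) * ε (i, l)) : ℤˣ) : ℝ) ≤
      Fintype.card (ι × κ → ℤˣ) * ((if i = k then 1 else 0) + if j = l then 1 else 0) := by
  by_cases hik : i = k
  · subst hik
    simp only [Int.units_mul_self, mul_one, if_true]
    simp only [Units.val_one, Int.cast_one, Finset.sum_const, Finset.card_univ, nsmul_eq_mul,
      mul_one]
    refine le_mul_of_one_le_right (Nat.cast_nonneg _) ?_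
    split_ifs <;> norm_num
  by_cases hjl : j = l
  · subst hjl
    simp only [Int.units_mul_self, if_neg hik, if_true, Units.val_one, Int.cast_one,
      Finset.sum_const, Finset.card_univ, nsmul_eq_mul, mul_one, zero_add, le_refl]
  rw [if_neg hik, if_neg hjl, add_zero, mul_zero]
  set F : (ι × κ → ℤˣ) → ℝ := fun ε => ((ε (k, j) * ε (i, j) * (ε (k, l) * ε (i, l)) : ℤˣ) : ℝ)
  -- Flipping the sign at the corner `(i, j)`, distinct from the other three, is a bijection of the
  -- sign choices that negates `F`.
  have hflip : ∀ ε, F (Pi.mulSingle (i, j) (-1) * ε) = -F ε := by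
    intro ε
    have h1 : (k, j) ≠ (i, j) := fun h => hik (Prod.ext_iff.1 h).1.symm
    have h2 : (k, l) ≠ (i, j) := fun h => hik (Prod.ext_iff.1 h).1.symm
    have h3 : (i, l) ≠ (i, j) := fun h => hjl (Prod.ext_iff.1 h).2.symm
    simp [F, Pi.mulSingle_eq_of_ne h1, Pi.mulSingle_eq_of_ne h2, Pi.mulSingle_eq_of_ne h3]
  have := Equiv.sum_comp (Equiv.mulLeft (Pi.mulSingle (i, j) (-1) : ι × κ → ℤˣ)) F
  simp only [Equiv.coe_mulLeft, hflip, Finset.sum_neg_distrib] at this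
  exact le_of_eq (by linarith)

/-- Some choice of signs on a `0-1` matrix makes the quartic sum at most its average. -/
theorem exists_signs_quartic_le (a : ι → κ → ℝ) (ha : ∀ i j, a i j ^ 2 = a i j) (D : ι → ℝ)
    (hD : ∀ i, 0 < D i) (hrow : ∀ i, ∑ j, a i j ≤ D i) (hcol : ∀ j, ∑ i, (D i)⁻¹ * a i j ≤ 1) :
    ∃ S : Matrix ι κ ℝ, (∀ i j, S i j ^ 2 = a i j) ∧
      ∑ i, ∑ k, (D k)⁻¹ * (∑ j, S k j * S i j) ^ 2 ≤ 2 * ∑ i, ∑ j, S i j ^ 2 := by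
  have ha0 : ∀ i j, 0 ≤ a i j := fun i j => ha i j ▸ sq_nonneg _
  let S : (ι × κ → ℤˣ) → Matrix ι κ ℝ := fun ε i j => a i j * ((ε (i, j) : ℤˣ) : ℝ)
  have hS : ∀ ε i j, S ε i j ^ 2 = a i j := by
    intro ε i j
    have : ((ε (i, j) : ℤˣ) : ℝ) ^ 2 = 1 := by
      rcases Int.units_eq_one_or (ε (i, j)) with h | h <;> simp [h]
    simp only [S, mul_pow, this, mul_one, ha]
  have hN : ∀ ε, ∑ i, ∑ j, S ε i j ^ 2 = ∑ i, ∑ j, a i j := fun ε => by simp only [hS]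
  have hexp : ∀ ε i k, (∑ j, S ε k j * S ε i j) ^ 2 =
      ∑ j, ∑ l, a k j * a i j * (a k l * a i l) *
        ((ε (k, j) * ε (i, j) * (ε (k, l) * ε (i, l)) : ℤˣ) : ℝ) := by
    intro ε i k
    rw [sq, Finset.sum_mul_sum]
    refine Finset.sum_congr rfl fun j _ => Finset.sum_congr rfl fun l _ => ?_
    simp only [S]
    push_cast
    ring
  have havg : ∑ ε : ι × κ → ℤˣ, ∑ i, ∑ k, (D k)⁻¹ * (∑ j, S ε k j * S ε i j) ^ 2 ≤
      ∑ ε : ι × κ → ℤˣ, 2 * ∑ i, ∑ j, S ε i j ^ 2 := by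
    set M : ℝ := (Fintype.card (ι × κ → ℤˣ) : ℝ) with hM
    have hM0 : 0 ≤ M := Nat.cast_nonneg _
    simp only [hN, hexp, Finset.sum_const, Finset.card_univ, nsmul_eq_mul, ← hM]
    calc _ = ∑ i, ∑ k, (D k)⁻¹ * ∑ j, ∑ l, a k j * a i j * (a k l * a i l) *
          ∑ ε : ι × κ → ℤˣ, ((ε (k, j) * ε (i, j) * (ε (k, l) * ε (i, l)) : ℤˣ) : ℝ) := by
          rw [Finset.sum_comm]
          refine Finset.sum_congr rfl fun i _ => ?_
          rw [Finset.sum_comm]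
          refine Finset.sum_congr rfl fun k _ => ?_
          rw [← Finset.mul_sum, Finset.sum_comm]
          congr 1
          refine Finset.sum_congr rfl fun j _ => ?_
          rw [Finset.sum_comm]
          exact Finset.sum_congr rfl fun l _ => (Finset.mul_sum _ _ _).symm
      _ ≤ ∑ i, ∑ k, (D k)⁻¹ * ∑ j, ∑ l, a k j * a i j * (a k l * a i l) *
          (M * ((if i = k then 1 else 0) + if j = l then 1 else 0)) := by
          gcongr with i _ k _ j _ l _
          · exact (inv_pos.2 (hD k)).le
          · exact mul_nonneg (mul_nonneg (ha0 _ _) (ha0 _ _)) (mul_nonneg (ha0 _ _) (ha0 _ _))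
          · exact sum_signs_rectangle_le i k j l
      _ = M * (∑ k, (D k)⁻¹ * (∑ j, a k j) ^ 2 + ∑ i, ∑ j, a i j * ∑ k, (D k)⁻¹ * a k j) := by
          have e1 : ∀ i k j, ∑ l, a k j * a i j * (a k l * a i l) *
              (M * ((if i = k then 1 else 0) + if j = l then 1 else 0)) =
              M * ((if i = k then a k j * ∑ l, a k l else 0) + a k j * a i j) := by
            intro i k j
            simp only [mul_add, Finset.sum_add_distrib, mul_ite, mul_one, mul_zero,
              Finset.sum_ite_eq, Finset.mem_univ, if_true]
            congr 1
            · split_ifs with h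
              · subst h
                simp only [← sq, ha, Finset.mul_sum]
                exact Finset.sum_congr rfl fun l _ => by ring
              · simp
            · linear_combination M * (a i j ^ 2 * ha k j + a k j * ha i j)
          simp only [e1, ← Finset.mul_sum, Finset.sum_add_distrib]
          simp only [mul_add, Finset.sum_add_distrib, Finset.mul_sum]
          congr 1
          · refine Finset.sum_congr rfl fun i _ => ?_
            rw [Finset.sum_eq_single i]
            · simp only [if_true, sq, Finset.mul_sum, Finset.sum_mul]
              refine Finset.sum_congr rfl fun j _ => Finset.sum_congr rfl fun l _ => by ring
            · intro k _ hk
              simp [hk.symm]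
            · simp
          · refine Finset.sum_congr rfl fun i _ => ?_
            rw [Finset.sum_comm]
            refine Finset.sum_congr rfl fun j _ => Finset.sum_congr rfl fun k _ => by ring
      _ ≤ M * (∑ i, ∑ j, a i j + ∑ i, ∑ j, a i j * 1) := by
          gcongr with k _ i _ j _
          · rw [sq, ← mul_assoc]
            refine mul_le_of_le_one_left (Finset.sum_nonneg fun j _ => ha0 k j) ?_
            rw [inv_mul_le_iff₀ (hD k), mul_one]
            exact hrow k
          · exact ha0 i j
          · exact hcol j
      _ = M * (2 * ∑ i, ∑ j, a i j) := by simp only [mul_one]; ring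
  obtain ⟨ε, -, hε⟩ := Finset.exists_le_of_sum_le Finset.univ_nonempty havg
  exact ⟨S ε, hS ε, hε⟩

/-- For a `0-1` matrix with at least as many columns as rows and `m` ones in each column there are
signs on it and a contraction whose weighted pairing is at least `√m / 2`. -/
theorem exists_signs_isContractive_pairing_ge [Nonempty κ] (a : ι → κ → ℝ)
    (ha : ∀ i j, a i j ^ 2 = a i j) {m : ℝ} (hm : 0 < m) (hcol : ∀ j, ∑ i, a i j = m)
    (hcard : Fintype.card ι ≤ Fintype.card κ) :
    ∃ (S T : Matrix ι κ ℝ) (η : ι → ℝ) (ξ : κ → ℝ), (∀ i j, S i j ^ 2 = a i j) ∧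
      IsContractive T ∧ ∑ i, η i ^ 2 ≤ 1 ∧ ∑ j, ξ j ^ 2 ≤ 1 ∧
      √m / 2 ≤ ∑ i, ∑ j, S i j * T i j * η i * ξ j := by
  have ha0 : ∀ i j, 0 ≤ a i j := fun i j => ha i j ▸ sq_nonneg _
  -- Dominating the row sums controls the terms `j = l = ...` replaced by `i = k` in the average,
  -- the floor `m` controls those with `j = l`, and the total of `D` is still at most `2 c m`.
  set D : ι → ℝ := fun i => max (∑ j, a i j) m with hDdef
  have hD : ∀ i, 0 < D i := fun i => hm.trans_le (le_max_right _ _)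
  obtain ⟨S, hS, hQ⟩ := exists_signs_quartic_le a ha D hD (fun i => le_max_left _ _) (by
    intro j
    calc ∑ i, (D i)⁻¹ * a i j ≤ ∑ i, m⁻¹ * a i j := by
          gcongr with i _
          · exact ha0 i j
          · exact le_max_right _ _
      _ = 1 := by rw [← Finset.mul_sum, hcol, inv_mul_cancel₀ hm.ne'])
  obtain ⟨T, hT, hpair⟩ := exists_isContractive_pairing_ge S D hD hQ
  set c : ℝ := (Fintype.card κ : ℝ) with hc
  have hc0 : 0 < c := Nat.cast_pos.2 Fintype.card_pos
  have hN : ∑ i, ∑ j, a i j = c * m := by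
    rw [Finset.sum_comm]
    simp only [hcol, Finset.sum_const, Finset.card_univ, nsmul_eq_mul, hc]
  have hDle : ∑ i, D i ≤ 2 * (c * m) := by
    calc ∑ i, D i ≤ ∑ i, (∑ j, a i j + m) := by
          refine Finset.sum_le_sum fun i _ => max_le ?_ ?_
          · linarith
          · linarith [Finset.sum_nonneg fun j (_ : j ∈ Finset.univ) => ha0 i j]
      _ = c * m + Fintype.card ι * m := by
          rw [Finset.sum_add_distrib, hN, Finset.sum_const, Finset.card_univ, nsmul_eq_mul]
      _ ≤ c * m + c * m := by
          gcongr
          simpa only [hc, Nat.cast_le] using hcard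
      _ = 2 * (c * m) := by ring
  refine ⟨S, T, fun i => √(D i) / √(2 * (c * m)), fun _ => 1 / √c, hS, hT, ?_, ?_, ?_⟩
  · simp only [div_pow, Real.sq_sqrt (hD _).le, Real.sq_sqrt (by positivity : 0 ≤ 2 * (c * m)),
      ← Finset.sum_div]
    exact div_le_one_of_le₀ hDle (by positivity)
  · simp only [div_pow, Real.sq_sqrt hc0.le, one_pow, Finset.sum_const, Finset.card_univ,
      nsmul_eq_mul, ← hc]
    rw [mul_one_div_cancel hc0.ne']
  · simp only [hS, hN] at hpair
    have e1 : ∑ i, ∑ j, S i j * T i j * (√(D i) / √(2 * (c * m))) * (1 / √c) =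
        (∑ i, ∑ j, S i j * T i j * √(D i)) / (√(2 * (c * m)) * √c) := by
      simp only [Finset.sum_div]
      refine Finset.sum_congr rfl fun i _ => Finset.sum_congr rfl fun j _ => ?_
      field_simp
    rw [e1, le_div_iff₀ (by positivity)]
    refine le_trans (le_of_eq ?_) hpair
    rw [Real.sqrt_mul zero_le_two, Real.sqrt_mul hc0.le]
    have h1 := Real.mul_self_sqrt hc0.le
    have h2 := Real.mul_self_sqrt hm.le
    linear_combination (√2 / 2) * (√m * √m * h1 + c * h2)

end Signs

end SchurPattern

namespace SchurPattern

/-! ### Upper bounds for Schur multipliers -/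

theorem sum_norm_sq_le (x : Ell2) (s : Finset ℕ) : ∑ i ∈ s, ‖x i‖ ^ 2 ≤ ‖x‖ ^ 2 := by
  simpa using lp.sum_rpow_le_norm_rpow (p := 2) (by norm_num) x s

theorem memℓp_two_of_forall_sum_le {f : ℕ → ℂ} {C : ℝ}
    (h : ∀ s : Finset ℕ, ∑ i ∈ s, ‖f i‖ ^ 2 ≤ C) : Memℓp f 2 :=
  memℓp_gen' (C := C) fun s => by simpa using h s

theorem norm_le_of_forall_sum_sq_le {x : Ell2} {C : ℝ} (hC : 0 ≤ C)
    (h : ∀ s : Finset ℕ, ∑ i ∈ s, ‖x i‖ ^ 2 ≤ C ^ 2) : ‖x‖ ≤ C :=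
  lp.norm_le_of_forall_sum_le (by norm_num) hC fun s => by simpa using h s

theorem entry_add (S T : Ell2 →L[ℂ] Ell2) (i j : ℕ) :
    entry (S + T) i j = entry S i j + entry T i j := rfl

theorem entry_smul (c : ℂ) (T : Ell2 →L[ℂ] Ell2) (i j : ℕ) :
    entry (c • T) i j = c * entry T i j := rfl

theorem sum_entry_column_le (T : Ell2 →L[ℂ] Ell2) (j : ℕ) (s : Finset ℕ) :
    ∑ i ∈ s, ‖entry T i j‖ ^ 2 ≤ ‖T‖ ^ 2 := by
  refine (sum_norm_sq_le _ s).trans ?_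
  gcongr
  refine (T.le_opNorm _).trans ?_
  rw [lp.norm_single (by norm_num), norm_one, mul_one]

/-- Cauchy–Schwarz over the at most `k` terms of each row costs a factor `k`; exchanging the sums
then leaves column sums of `|entry T i j|²`, each at most `‖T‖²`. -/
theorem sum_rowAction_sq_le {X : Matrix ℕ ℕ ℂ} (hX : ∀ i j, ‖X i j‖ ≤ 1) {F : ℕ → Finset ℕ}
    {k : ℕ} (hF : ∀ i, (F i).card ≤ k) (T : Ell2 →L[ℂ] Ell2) (x : Ell2) (s : Finset ℕ) :
    ∑ i ∈ s, ‖∑ j ∈ F i, X i j * entry T i j * x j‖ ^ 2 ≤ (√k * ‖T‖ * ‖x‖) ^ 2 := by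
  have h1 : ∀ i, ‖∑ j ∈ F i, X i j * entry T i j * x j‖ ^ 2 ≤
      k * ∑ j ∈ F i, ‖entry T i j‖ ^ 2 * ‖x j‖ ^ 2 := by
    intro i
    calc ‖∑ j ∈ F i, X i j * entry T i j * x j‖ ^ 2
        ≤ (∑ j ∈ F i, ‖entry T i j‖ * ‖x j‖) ^ 2 := by
          gcongr
          refine (norm_sum_le _ _).trans (Finset.sum_le_sum fun j _ => ?_)
          rw [norm_mul, norm_mul]
          exact mul_le_mul_of_nonneg_right
            (mul_le_of_le_one_left (norm_nonneg _) (hX i j)) (norm_nonneg _)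
      _ ≤ (F i).card * ∑ j ∈ F i, (‖entry T i j‖ * ‖x j‖) ^ 2 := sq_sum_le_card_mul_sum_sq
      _ ≤ k * ∑ j ∈ F i, (‖entry T i j‖ * ‖x j‖) ^ 2 := by
          gcongr
          exact hF i
      _ = _ := by simp only [mul_pow]
  calc _ ≤ ∑ i ∈ s, k * ∑ j ∈ F i, ‖entry T i j‖ ^ 2 * ‖x j‖ ^ 2 :=
        Finset.sum_le_sum fun i _ => h1 i
    -- A common index set for all rows makes the sums exchangeable.
    _ ≤ ∑ i ∈ s, k * ∑ j ∈ s.biUnion F, ‖entry T i j‖ ^ 2 * ‖x j‖ ^ 2 := by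
        gcongr with i hi
        exact Finset.subset_biUnion_of_mem F hi
    _ = k * ∑ j ∈ s.biUnion F, (∑ i ∈ s, ‖entry T i j‖ ^ 2) * ‖x j‖ ^ 2 := by
        rw [← Finset.mul_sum, Finset.sum_comm]
        simp only [Finset.sum_mul]
    _ ≤ k * ∑ j ∈ s.biUnion F, ‖T‖ ^ 2 * ‖x j‖ ^ 2 := by
        gcongr with j _
        exact sum_entry_column_le T j s
    _ ≤ k * (‖T‖ ^ 2 * ‖x‖ ^ 2) := by
        rw [← Finset.mul_sum]
        gcongr
        exact sum_norm_sq_le x _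
    _ = (√k * ‖T‖ * ‖x‖) ^ 2 := by
        rw [mul_pow, mul_pow, Real.sq_sqrt (Nat.cast_nonneg k), mul_assoc]

theorem exists_isSchurMultiplier_of_rowBounded {Q : Set (ℕ × ℕ)} {k : ℕ} (hQ : RowBounded Q k)
    {X : Matrix ℕ ℕ ℂ} (hX : X ∈ supportedMatrices Q) :
    ∃ Φ : (Ell2 →L[ℂ] Ell2) →L[ℂ] (Ell2 →L[ℂ] Ell2), IsSchurMultiplier X Φ ∧ ‖Φ‖ ≤ √k := by
  have hfin : ∀ i, {j | (i, j) ∈ Q}.Finite := fun i =>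
    Set.finite_of_encard_le_coe (hQ i)
  set F : ℕ → Finset ℕ := fun i => (hfin i).toFinset with hFdef
  have hF : ∀ i, (F i).card ≤ k := fun i => by
    have := hQ i
    rw [(hfin i).encard_eq_coe_toFinset_card] at this
    exact_mod_cast this
  have hb := sum_rowAction_sq_le hX.2 hF
  let act : (Ell2 →L[ℂ] Ell2) → Ell2 → Ell2 := fun T x =>
    ⟨fun i => ∑ j ∈ F i, X i j * entry T i j * x j, memℓp_two_of_forall_sum_le (hb T x)⟩
  have hact : ∀ T x i, (act T x : Ell2) i = ∑ j ∈ F i, X i j * entry T i j * x j :=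
    fun _ _ _ => rfl
  let f : (Ell2 →L[ℂ] Ell2) →ₗ[ℂ] Ell2 →ₗ[ℂ] Ell2 := LinearMap.mk₂ ℂ act
    (fun S T x => lp.ext <| funext fun i => by
      simp only [hact, lp.coeFn_add, Pi.add_apply, entry_add, mul_add, add_mul,
        Finset.sum_add_distrib])
    (fun c T x => lp.ext <| funext fun i => by
      simp only [hact, lp.coeFn_smul, Pi.smul_apply, entry_smul, smul_eq_mul, Finset.mul_sum]
      exact Finset.sum_congr rfl fun j _ => by ring)
    (fun T x y => lp.ext <| funext fun i => by
      simp only [hact, lp.coeFn_add, Pi.add_apply, mul_add, Finset.sum_add_distrib])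
    (fun c T x => lp.ext <| funext fun i => by
      simp only [hact, lp.coeFn_smul, Pi.smul_apply, smul_eq_mul, Finset.mul_sum]
      exact Finset.sum_congr rfl fun j _ => by ring)
  have hf : ∀ T x, ‖f T x‖ ≤ √k * ‖T‖ * ‖x‖ := fun T x =>
    norm_le_of_forall_sum_sq_le (by positivity) (hb T x)
  refine ⟨f.mkContinuous₂ _ hf, fun T i j => ?_,
    LinearMap.mkContinuous₂_norm_le _ (Real.sqrt_nonneg _) _⟩
  change ∑ l ∈ F i, X i l * entry T i l * (lp.single 2 j (1 : ℂ) : Ell2) l = _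
  rw [Finset.sum_eq_single j]
  · simp [lp.single_apply]
  · intro l _ hl
    simp [lp.single_apply, hl]
  · intro hj
    have : X i j = 0 := by
      by_contra h
      exact hj ((hfin i).mem_toFinset.2 (hX.1 i j h))
    simp [this]

theorem entry_eq_inner (T : Ell2 →L[ℂ] Ell2) (i j : ℕ) :
    entry T i j = inner ℂ (lp.single 2 i (1 : ℂ) : Ell2) (T (lp.single 2 j (1 : ℂ))) := by
  rw [lp.inner_single_left]
  simp [entry]

theorem entry_adjoint (T : Ell2 →L[ℂ] Ell2) (i j : ℕ) :
    entry (ContinuousLinearMap.adjoint T) i j = star (entry T j i) := by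
  rw [entry_eq_inner, entry_eq_inner, ContinuousLinearMap.adjoint_inner_right,
    ← inner_conj_symm]
  rfl

-- Conjugating the row bounded case by the adjoint, `T ↦ Φ(T*)*` with `Φ` the multiplier of
-- `X.conjTranspose`; the two conjugations cancel, so the map is linear.
open ContinuousLinearMap in
theorem exists_isSchurMultiplier_of_columnBounded {Q : Set (ℕ × ℕ)} {k : ℕ}
    (hQ : ColumnBounded Q k) {X : Matrix ℕ ℕ ℂ} (hX : X ∈ supportedMatrices Q) :
    ∃ Φ : (Ell2 →L[ℂ] Ell2) →L[ℂ] (Ell2 →L[ℂ] Ell2), IsSchurMultiplier X Φ ∧ ‖Φ‖ ≤ √k := by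
  obtain ⟨Φ, hΦ, hn⟩ := exists_isSchurMultiplier_of_rowBounded (Q := Prod.swap ⁻¹' Q)
    (k := k) (X := X.conjTranspose) (fun j => hQ j)
    ⟨fun i j h => hX.1 j i fun h0 => h (by simp [h0]), fun i j => by simpa using hX.2 j i⟩
  let f : (Ell2 →L[ℂ] Ell2) →ₗ[ℂ] (Ell2 →L[ℂ] Ell2) :=
    { toFun := fun T => adjoint (Φ (adjoint T))
      map_add' := fun S T => by simp only [map_add]
      map_smul' := fun c T => by
        simp only [map_smulₛₗ, RingHom.id_apply, Complex.conj_conj] }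
  refine ⟨f.mkContinuous (√k) fun T => ?_, fun T i j => ?_,
    LinearMap.mkContinuous_norm_le _ (Real.sqrt_nonneg _) _⟩
  · change ‖adjoint (Φ (adjoint T))‖ ≤ _
    rw [LinearIsometryEquiv.norm_map]
    refine (Φ.le_opNorm _).trans ?_
    rw [LinearIsometryEquiv.norm_map]
    gcongr
  · change entry (adjoint (Φ (adjoint T))) i j = _
    rw [entry_adjoint, hΦ, entry_adjoint, Matrix.conjTranspose_apply, star_mul', star_star,
      star_star]

theorem exists_isSchurMultiplier_of_union {Pr Pc : Set (ℕ × ℕ)} {k l : ℕ}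
    (hr : RowBounded Pr k) (hc : ColumnBounded Pc l) {X : Matrix ℕ ℕ ℂ}
    (hX : X ∈ supportedMatrices (Pr ∪ Pc)) :
    ∃ Φ : (Ell2 →L[ℂ] Ell2) →L[ℂ] (Ell2 →L[ℂ] Ell2), IsSchurMultiplier X Φ ∧
      ‖Φ‖ ≤ √k + √l := by
  classical
  obtain ⟨Φ, hΦ, hΦn⟩ := exists_isSchurMultiplier_of_rowBounded hr
    (X := fun i j => if (i, j) ∈ Pr then X i j else 0)
    ⟨fun i j h => by
      by_contra h0
      simp [h0] at h, fun i j => by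
      dsimp only
      split_ifs
      · exact hX.2 i j
      · simp⟩
  obtain ⟨Ψ, hΨ, hΨn⟩ := exists_isSchurMultiplier_of_columnBounded hc
    (X := fun i j => if (i, j) ∈ Pr then 0 else X i j)
    ⟨fun i j h => by
      by_cases h0 : (i, j) ∈ Pr
      · simp [h0] at h
      · exact (hX.1 i j (by simpa [h0] using h)).resolve_left h0, fun i j => by
      dsimp only
      split_ifs
      · simp
      · exact hX.2 i j⟩
  refine ⟨Φ + Ψ, fun T i j => ?_, (Φ.opNorm_add_le Ψ).trans (add_le_add hΦn hΨn)⟩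
  rw [add_apply, entry_add, hΦ, hΨ]
  dsimp only
  split_ifs <;> simp

theorem schurBound_union_le {Pr Pc : Set (ℕ × ℕ)} {k : ℕ}
    (hr : RowBounded Pr k) (hc : ColumnBounded Pc k) :
    schurBound (Pr ∪ Pc) ≤ ENNReal.ofReal (2 * √k) := by
  refine iSup₂_le fun X hX => ?_
  obtain ⟨Φ, hΦ, hn⟩ := exists_isSchurMultiplier_of_union hr hc hX
  rw [schurNorm_eq hΦ, ← ofReal_norm]
  exact ENNReal.ofReal_le_ofReal (by linarith)

/-! ### Uniform boundedness from the closed graph theorem -/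

/-- A linear family of bounded operators with closed graph is bounded. -/
theorem exists_opNorm_le_of_closed_graph {E V : Type*} [NormedAddCommGroup E] [NormedSpace ℂ E]
    [CompleteSpace E] [NormedAddCommGroup V] [NormedSpace ℂ V] [CompleteSpace V]
    (M : E → V →L[ℂ] V) (hadd : ∀ x y, M (x + y) = M x + M y)
    (hsmul : ∀ (c : ℂ) x, M (c • x) = c • M x)
    (hclosed : ∀ (u : ℕ → E) (x : E) (Ψ : V →L[ℂ] V), Filter.Tendsto u Filter.atTop (nhds x) →
      (∀ v, Filter.Tendsto (fun n => M (u n) v) Filter.atTop (nhds (Ψ v))) → Ψ = M x) :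
    ∃ K : ℝ, ∀ x, ‖M x‖ ≤ K * ‖x‖ := by
  let g : E →ₗ[ℂ] V →L[ℂ] V := { toFun := M, map_add' := hadd, map_smul' := hsmul }
  have hg : Continuous g := by
    refine g.continuous_of_seq_closed_graph fun u x Ψ hu hΨ => hclosed u x Ψ hu fun v => ?_
    exact ((ContinuousLinearMap.apply ℂ V v).continuous.tendsto Ψ).comp hΨ
  exact ⟨_, (⟨g, hg⟩ : E →L[ℂ] V →L[ℂ] V).le_opNorm⟩

/-- By the closed graph theorem, the Schur bound of a Schur bounded pattern is finite. -/
theorem SchurBounded.exists_norm_le {P : Set (ℕ × ℕ)} (hP : SchurBounded P) :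
    ∃ K : ℝ, ∀ X ∈ supportedMatrices P,
      ∀ Φ : (Ell2 →L[ℂ] Ell2) →L[ℂ] (Ell2 →L[ℂ] Ell2), IsSchurMultiplier X Φ → ‖Φ‖ ≤ K := by
  classical
  let mat : lp (fun _ : P => ℂ) ∞ → Matrix ℕ ℕ ℂ := fun x i j =>
    if h : (i, j) ∈ P then x ⟨(i, j), h⟩ else 0
  have hmat : ∀ x, ∃ Φ, IsSchurMultiplier (mat x) Φ := by
    intro x
    -- Scaling by `‖x‖ + 1` brings the entries into the unit disc and stays invertible at `x = 0`.
    obtain ⟨Φ, hΦ⟩ := hP (fun i j => ((‖x‖ + 1 : ℝ) : ℂ)⁻¹ * mat x i j) ⟨fun i j h => by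
        by_contra h0
        simp [mat, h0] at h, fun i j => by
        have h1 : ‖mat x i j‖ ≤ ‖x‖ := by
          simp only [mat]
          split_ifs with h
          · exact lp.norm_apply_le_norm (by simp) x _
          · simp
        have h2 : (0 : ℝ) < ‖x‖ + 1 := by positivity
        rw [norm_mul, norm_inv, Complex.norm_real, Real.norm_of_nonneg h2.le,
          inv_mul_le_iff₀ h2]
        linarith⟩
    refine ⟨((‖x‖ + 1 : ℝ) : ℂ) • Φ, fun T i j => ?_⟩
    have h2 : ((‖x‖ + 1 : ℝ) : ℂ) ≠ 0 := Complex.ofReal_ne_zero.2 (by positivity)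
    rw [smul_apply, entry_smul, hΦ, ← mul_assoc, mul_inv_cancel_left₀ h2]
  choose M hM using hmat
  have mat_add : ∀ x y i j, mat (x + y) i j = mat x i j + mat y i j := fun x y i j => by
    simp only [mat]
    split_ifs <;> simp
  have mat_smul : ∀ (c : ℂ) x i j, mat (c • x) i j = c * mat x i j := fun c x i j => by
    simp only [mat]
    split_ifs <;> simp
  obtain ⟨K, hK⟩ := exists_opNorm_le_of_closed_graph M
    (fun x y => (hM (x + y)).unique fun T i j => by
      rw [add_apply, entry_add, hM, hM, mat_add, add_mul])
    (fun c x => (hM (c • x)).unique fun T i j => by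
      rw [smul_apply, entry_smul, hM, mat_smul, mul_assoc])
    -- The graph is closed because matrix entries depend continuously on the operator and on `x`,
    -- and they determine the multiplier.
    (fun u x Ψ hu hΨ => by
      refine (IsSchurMultiplier.unique (A := mat x) (hM x) fun T i j => ?_).symm
      have h1 : Filter.Tendsto (fun n => entry (M (u n) T) i j) Filter.atTop
          (nhds (entry (Ψ T) i j)) := by
        have hc : Continuous fun T : Ell2 →L[ℂ] Ell2 => entry T i j := by
          simp only [entry_eq_inner]
          fun_prop
        exact (hc.tendsto (Ψ T)).comp (hΨ T)
      have h2 : Filter.Tendsto (fun n => mat (u n) i j) Filter.atTop (nhds (mat x i j)) := by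
        simp only [mat]
        split_ifs with h
        · exact ((lp.evalCLM ℂ (fun _ : P => ℂ) ∞ ⟨(i, j), h⟩).continuous.tendsto x).comp hu
        · exact tendsto_const_nhds
      refine tendsto_nhds_unique h1 ?_
      simp only [hM _ T i j]
      exact h2.mul_const _)
  refine ⟨|K|, fun X hX Φ hΦ => ?_⟩
  let x : lp (fun _ : P => ℂ) ∞ := ⟨fun e => X e.1.1 e.1.2,
    memℓp_infty ⟨1, by rintro _ ⟨e, rfl⟩; exact hX.2 _ _⟩⟩
  have hx : ‖x‖ ≤ 1 := lp.norm_le_of_forall_le zero_le_one fun e => hX.2 _ _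
  have hmx : mat x = X := by
    ext i j
    simp only [mat]
    split_ifs with h
    · rfl
    · by_contra h0
      exact h (hX.1 i j (Ne.symm h0))
  have hMx : Φ = M x := hΦ.unique (hmx ▸ hM x)
  rw [hMx]
  calc ‖M x‖ ≤ K * ‖x‖ := hK x
    _ ≤ |K| * ‖x‖ := by gcongr; exact le_abs_self K
    _ ≤ |K| := mul_le_of_le_one_right (abs_nonneg K) hx

end SchurPattern

namespace SchurPattern

/-! ### Placing finite matrices in `ℓ²(ℕ)` -/

section Embedding

variable {ι κ : Type*} [Fintype ι] [Fintype κ]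

/-- The vector in `ℓ²(ℕ)` with the coordinates `η i` at the places `f i`. -/
noncomputable def placedVector (f : ι ↪ ℕ) (η : ι → ℝ) : Ell2 :=
  ∑ i, (η i : ℂ) • (lp.single 2 (f i) (1 : ℂ) : Ell2)

theorem placedVector_apply (f : ι ↪ ℕ) (η : ι → ℝ) (i : ι) :
    (placedVector f η : Ell2) (f i) = η i := by
  classical
  rw [placedVector, lp.coeFn_sum, Finset.sum_apply, Finset.sum_eq_single i]
  · rw [lp.coeFn_smul, Pi.smul_apply, lp.single_apply, Pi.single_eq_same, smul_eq_mul, mul_one]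
  · intro k _ hk
    rw [lp.coeFn_smul, Pi.smul_apply, lp.single_apply,
      Pi.single_eq_of_ne (f.injective.ne hk).symm, smul_zero]
  · simp

theorem inner_placedVector_left (f : ι ↪ ℕ) (η : ι → ℝ) (x : Ell2) :
    inner ℂ (placedVector f η) x = ∑ i, (η i : ℂ) * x (f i) := by
  simp only [placedVector, sum_inner, inner_smul_left, lp.inner_single_left, Complex.conj_ofReal]
  simp

theorem norm_placedVector_le (f : ι ↪ ℕ) {η : ι → ℝ} (h : ∑ i, η i ^ 2 ≤ 1) :
    ‖placedVector f η‖ ≤ 1 := by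
  have h1 : ‖placedVector f η‖ ^ 2 = ∑ i, η i ^ 2 := by
    have h2 : inner ℂ (placedVector f η) (placedVector f η) = ((∑ i, η i ^ 2 : ℝ) : ℂ) := by
      rw [inner_placedVector_left]
      push_cast
      exact Finset.sum_congr rfl fun i _ => by rw [placedVector_apply, sq]
    rw [← inner_self_eq_norm_sq (𝕜 := ℂ), h2]
    exact Complex.ofReal_re _
  rw [← h1] at h
  exact (sq_le_one_iff₀ (norm_nonneg _)).1 h

/-- The operator on `ℓ²(ℕ)` with the matrix entries `T i j` at the places `(f i, g j)`. -/
noncomputable def placedOperator (f : ι ↪ ℕ) (g : κ ↪ ℕ) (T : Matrix ι κ ℝ) : Ell2 →L[ℂ] Ell2 :=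
  ∑ i, ∑ j, (T i j : ℂ) • InnerProductSpace.rankOne ℂ
    (lp.single 2 (f i) (1 : ℂ) : Ell2) (lp.single 2 (g j) (1 : ℂ) : Ell2)

theorem inner_placedOperator (f : ι ↪ ℕ) (g : κ ↪ ℕ) (T : Matrix ι κ ℝ) (x y : Ell2) :
    inner ℂ y (placedOperator f g T x) =
      ∑ i, ∑ j, (T i j : ℂ) * (x (g j) * star (y (f i))) := by
  simp only [placedOperator, sum_apply, smul_apply,
    InnerProductSpace.rankOne_apply, inner_sum, inner_smul_right, lp.inner_single_left,
    lp.inner_single_right]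
  simp

theorem entry_placedOperator (f : ι ↪ ℕ) (g : κ ↪ ℕ) (T : Matrix ι κ ℝ) (i : ι) (j : κ) :
    entry (placedOperator f g T) (f i) (g j) = T i j := by
  classical
  rw [entry_eq_inner, inner_placedOperator, Finset.sum_eq_single i, Finset.sum_eq_single j]
  · simp [lp.single_apply]
  · intro l _ hl
    simp [lp.single_apply, g.injective.ne hl]
  · simp
  · intro k _ hk
    simp [lp.single_apply, f.injective.ne hk]
  · simp

theorem sum_embedding_norm_sq_le (f : ι ↪ ℕ) (x : Ell2) : ∑ i, ‖x (f i)‖ ^ 2 ≤ ‖x‖ ^ 2 := by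
  simpa using sum_norm_sq_le x (Finset.univ.map f)

theorem norm_placedOperator_le (f : ι ↪ ℕ) (g : κ ↪ ℕ) {T : Matrix ι κ ℝ}
    (hT : IsContractive T) : ‖placedOperator f g T‖ ≤ 1 := by
  refine ContinuousLinearMap.opNorm_le_bound _ zero_le_one fun x => ?_
  set y := placedOperator f g T x with hy
  let xr : κ → ℝ := fun j => (x (g j)).re
  let xi : κ → ℝ := fun j => (x (g j)).im
  let yr : ι → ℝ := fun i => (y (f i)).re
  let yi : ι → ℝ := fun i => (y (f i)).im
  -- `T` is real, so it acts separately on real and imaginary parts and the real contraction bound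
  -- applies to each.
  have h1 : ‖y‖ ^ 2 = yr ⬝ᵥ T.mulVec xr + yi ⬝ᵥ T.mulVec xi := by
    rw [← inner_self_eq_norm_sq (𝕜 := ℂ)]
    conv_lhs => rw [hy]
    rw [inner_placedOperator, ← hy, map_sum]
    simp only [dotProduct, Matrix.mulVec, ← Finset.sum_add_distrib, Finset.mul_sum, map_sum]
    refine Finset.sum_congr rfl fun i _ => Finset.sum_congr rfl fun j _ => ?_
    simp [xr, xi, yr, yi]
    ring
  have h2 : xr ⬝ᵥ xr + xi ⬝ᵥ xi ≤ ‖x‖ ^ 2 := by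
    refine le_trans (le_of_eq ?_) (sum_embedding_norm_sq_le g x)
    simp only [dotProduct, ← Finset.sum_add_distrib, Complex.sq_norm, Complex.normSq_apply, xr, xi]
  have h3 : yr ⬝ᵥ yr + yi ⬝ᵥ yi ≤ ‖y‖ ^ 2 := by
    refine le_trans (le_of_eq ?_) (sum_embedding_norm_sq_le f y)
    simp only [dotProduct, ← Finset.sum_add_distrib, Complex.sq_norm, Complex.normSq_apply, yr, yi]
  have h4 := hT yr xr
  have h5 := hT yi xi
  have p1 := dotProduct_self_nonneg' xr
  have p2 := dotProduct_self_nonneg' xi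
  have p3 := dotProduct_self_nonneg' yr
  have p4 := dotProduct_self_nonneg' yi
  have h6 : (‖y‖ ^ 2) ^ 2 ≤ ‖y‖ ^ 2 * ‖x‖ ^ 2 := by
    calc (‖y‖ ^ 2) ^ 2 ≤ (yr ⬝ᵥ yr + yi ⬝ᵥ yi) * (xr ⬝ᵥ xr + xi ⬝ᵥ xi) := by
          rw [h1]
          generalize yr ⬝ᵥ yr = A at *
          generalize yi ⬝ᵥ yi = B at *
          generalize xr ⬝ᵥ xr = A' at *
          generalize xi ⬝ᵥ xi = B' at *
          generalize yr ⬝ᵥ T.mulVec xr = p at *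
          generalize yi ⬝ᵥ T.mulVec xi = q at *
          -- The cross term of `(p + q)²`, by AM-GM from `p² ≤ A A'` and `q² ≤ B B'`.
          have h7 : 2 * (p * q) ≤ A * B' + B * A' := by
            refine abs_le_of_sq_le_sq' ?_ (by positivity) |>.2
            have h8 : (p * q) ^ 2 ≤ (A * A') * (B * B') := by
              rw [mul_pow]
              exact mul_le_mul h4 h5 (sq_nonneg q) (by positivity)
            nlinarith [sq_nonneg (A * B' - B * A')]
          linarith
      _ ≤ _ := mul_le_mul h3 h2 (by linarith) (sq_nonneg _)
  rw [one_mul]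
  rcases eq_or_ne ‖y‖ 0 with h0 | h0
  · rw [h0]
    exact norm_nonneg x
  · have h7 : 0 < ‖y‖ ^ 2 := by positivity
    rw [sq (‖y‖ ^ 2)] at h6
    exact (sq_le_sq₀ (norm_nonneg _) (norm_nonneg _)).1 (le_of_mul_le_mul_left h6 h7)

/-- Pairing with a contraction bounds the norm of a Schur multiplier from below. -/
theorem IsSchurMultiplier.pairing_le {X : Matrix ℕ ℕ ℂ}
    {Φ : (Ell2 →L[ℂ] Ell2) →L[ℂ] (Ell2 →L[ℂ] Ell2)} (hΦ : IsSchurMultiplier X Φ)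
    (f : ι ↪ ℕ) (g : κ ↪ ℕ) {S T : Matrix ι κ ℝ} (hS : ∀ i j, X (f i) (g j) = S i j)
    (hT : IsContractive T) {η : ι → ℝ} {ξ : κ → ℝ} (hη : ∑ i, η i ^ 2 ≤ 1)
    (hξ : ∑ j, ξ j ^ 2 ≤ 1) :
    ∑ i, ∑ j, S i j * T i j * η i * ξ j ≤ ‖Φ‖ := by
  have h1 : inner ℂ (placedVector f η) (Φ (placedOperator f g T) (placedVector g ξ)) =
      ((∑ i, ∑ j, S i j * T i j * η i * ξ j : ℝ) : ℂ) := by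
    rw [inner_placedVector_left]
    push_cast
    refine Finset.sum_congr rfl fun i _ => ?_
    have h2 : (Φ (placedOperator f g T) (placedVector g ξ)) (f i) =
        ∑ j, (ξ j : ℂ) * entry (Φ (placedOperator f g T)) (f i) (g j) := by
      rw [placedVector, map_sum, lp.coeFn_sum, Finset.sum_apply]
      refine Finset.sum_congr rfl fun j _ => ?_
      rw [map_smul]
      rfl
    rw [h2, Finset.mul_sum]
    refine Finset.sum_congr rfl fun j _ => ?_
    rw [hΦ, entry_placedOperator, hS]
    ring
  calc _ ≤ ‖((∑ i, ∑ j, S i j * T i j * η i * ξ j : ℝ) : ℂ)‖ := by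
        rw [Complex.norm_real]
        exact le_abs_self _
    _ ≤ ‖placedVector f η‖ * ‖Φ (placedOperator f g T) (placedVector g ξ)‖ := by
        rw [← h1]
        exact norm_inner_le_norm _ _
    _ ≤ 1 * (‖Φ‖ * 1 * 1) := by
        gcongr
        · exact norm_placedVector_le f hη
        · refine (ContinuousLinearMap.le_opNorm _ _).trans ?_
          gcongr
          · refine (Φ.le_opNorm _).trans ?_
            gcongr
            exact norm_placedOperator_le f g hT
          · exact norm_placedVector_le g hξ
    _ = ‖Φ‖ := by ring

end Embedding

/-! ### Lower bound for dense patterns -/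

open scoped Classical in
/-- A finite rectangle all of whose columns hold `m` entries of the pattern `N` and which has at
least as many columns as rows carries signs on `N` that pair to at least `√m / 2`. -/
theorem exists_signs_pairing_ge_of_columns {m : ℕ} (hm : 0 < m) {R C : Finset ℕ}
    (hC : C.Nonempty) (hcard : R.card ≤ C.card) (N : ℕ → ℕ → Prop)
    (h : ∀ j ∈ C, m ≤ (R.filter fun i => N i j).card) :
    ∃ (S T : Matrix R C ℝ) (η : R → ℝ) (ξ : C → ℝ), (∀ i j, S i j ≠ 0 → N i j) ∧
      (∀ i j, |S i j| ≤ 1) ∧ IsContractive T ∧ ∑ i, η i ^ 2 ≤ 1 ∧ ∑ j, ξ j ^ 2 ≤ 1 ∧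
      √m / 2 ≤ ∑ i, ∑ j, S i j * T i j * η i * ξ j := by
  have : Nonempty C := hC.coe_sort
  -- Each column is thinned to exactly `m` entries, since the averaging argument needs equal column
  -- sums.
  choose! A hA hAm using fun j hj => Finset.exists_subset_card_eq (h j hj)
  obtain ⟨S, T, η, ξ, hS, hT, hη, hξ, hp⟩ := exists_signs_isContractive_pairing_ge
    (ι := R) (κ := C) (fun i j => if (i : ℕ) ∈ A j then 1 else 0)
    (fun i j => by split_ifs <;> norm_num) (m := m) (Nat.cast_pos.2 hm) (fun j => by
      rw [Finset.sum_coe_sort R fun i => if i ∈ A j then (1 : ℝ) else 0, Finset.sum_boole,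
        Finset.filter_mem_eq_inter, Finset.inter_eq_right.2
          ((hA j j.2).trans (Finset.filter_subset _ _)), hAm j j.2])
    (by simpa using hcard)
  refine ⟨S, T, η, ξ, fun i j hij => ?_, fun i j => ?_, hT, hη, hξ, hp⟩
  · by_contra hN
    have : (i : ℕ) ∉ A j := fun hi => hN (Finset.mem_filter.1 (hA j j.2 hi)).2
    have h0 := hS i j
    rw [if_neg this] at h0
    exact hij (by simpa using h0)
  · rw [← sq_le_one_iff_abs_le_one, hS]
    split_ifs <;> norm_num

/-- A pattern which is dense in some finite rectangle supports a matrix of large Schur norm. -/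
theorem exists_supportedMatrix_norm_ge {P : Set (ℕ × ℕ)} {k : ℕ} {R C : Finset ℕ}
    (h : k * (R.card + C.card) < rectCount P R C) :
    ∃ X ∈ supportedMatrices P, ∀ Φ : (Ell2 →L[ℂ] Ell2) →L[ℂ] (Ell2 →L[ℂ] Ell2),
      IsSchurMultiplier X Φ → √(k + 1 : ℕ) / 2 ≤ ‖Φ‖ := by
  classical
  obtain ⟨R, C, hR, hC, hrow, hcol⟩ := exists_min_degree R C h
  have key : ∃ (S T : Matrix R C ℝ) (η : R → ℝ) (ξ : C → ℝ),
      (∀ i j, S i j ≠ 0 → ((i : ℕ), (j : ℕ)) ∈ P) ∧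
      (∀ i j, |S i j| ≤ 1) ∧ IsContractive T ∧ ∑ i, η i ^ 2 ≤ 1 ∧ ∑ j, ξ j ^ 2 ≤ 1 ∧
      √(k + 1 : ℕ) / 2 ≤ ∑ i, ∑ j, S i j * T i j * η i * ξ j := by
    rcases le_total R.card C.card with hle | hle
    · exact exists_signs_pairing_ge_of_columns k.succ_pos hC hle (fun i j => (i, j) ∈ P) hcol
    · obtain ⟨S, T, η, ξ, hS, hS1, hT, hη, hξ, hp⟩ :=
        exists_signs_pairing_ge_of_columns k.succ_pos hR hle (fun j i => (i, j) ∈ P) hrow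
      refine ⟨S.transpose, T.transpose, ξ, η, fun i j => hS j i, fun i j => hS1 j i,
        hT.transpose, hξ, hη, hp.trans (le_of_eq ?_)⟩
      rw [Finset.sum_comm]
      refine Finset.sum_congr rfl fun i _ => Finset.sum_congr rfl fun j _ => ?_
      simp only [Matrix.transpose_apply]
      ring
  obtain ⟨S, T, η, ξ, hS, hS1, hT, hη, hξ, hp⟩ := key
  let X : Matrix ℕ ℕ ℂ := fun i j =>
    if h : i ∈ R ∧ j ∈ C then (S ⟨i, h.1⟩ ⟨j, h.2⟩ : ℂ) else 0
  refine ⟨X, ⟨fun i j hij => ?_, fun i j => ?_⟩, fun Φ hΦ => hp.trans ?_⟩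
  · by_cases hm : i ∈ R ∧ j ∈ C
    · simp only [X, dif_pos hm, ne_eq, Complex.ofReal_eq_zero] at hij
      exact hS _ _ hij
    · simp [X, hm] at hij
  · simp only [X]
    split_ifs
    · rw [Complex.norm_real]
      exact hS1 _ _
    · simp
  · exact hΦ.pairing_le (Function.Embedding.subtype _) (Function.Embedding.subtype _)
      (fun i j => by simp [X]) hT hη hξ

theorem exists_rectCount_gt {P : Set (ℕ × ℕ)} {k : ℕ} (h : ¬density P ≤ (k : ℝ≥0∞)) :
    ∃ R C : Finset ℕ, k * (R.card + C.card) < rectCount P R C := by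
  rw [density_le_natCast_iff] at h
  push Not at h
  exact h

theorem schurBound_ge {P : Set (ℕ × ℕ)} {k : ℕ} (h : ¬density P ≤ (k : ℝ≥0∞)) :
    ENNReal.ofReal (√(k + 1 : ℕ) / 2) ≤ schurBound P := by
  obtain ⟨R, C, hRC⟩ := exists_rectCount_gt h
  obtain ⟨X, hX, hn⟩ := exists_supportedMatrix_norm_ge hRC
  refine le_iSup₂_of_le X hX (le_iInf₂ fun Φ hΦ => ?_)
  rw [← ofReal_norm]
  exact ENNReal.ofReal_le_ofReal (hn Φ hΦ)

theorem SchurBounded.density_lt_top {P : Set (ℕ × ℕ)} (hP : SchurBounded P) :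
    density P < ⊤ := by
  obtain ⟨K, hK⟩ := hP.exists_norm_le
  -- Density above `k` would give `√(k + 1) / 2 ≤ K`, hence `k + 1 ≤ (2K)²`.
  obtain ⟨k, hk⟩ := exists_nat_gt ((2 * K) ^ 2)
  by_contra htop
  have h0 : ¬density P ≤ (k : ℝ≥0∞) := fun h =>
    htop (h.trans_lt (ENNReal.natCast_lt_top k))
  obtain ⟨R, C, hRC⟩ := exists_rectCount_gt h0
  obtain ⟨X, hX, hn⟩ := exists_supportedMatrix_norm_ge hRC
  obtain ⟨Φ, hΦ⟩ := hP X hX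
  have h1 := (hn Φ hΦ).trans (hK X hX Φ hΦ)
  have h2 : √(k + 1 : ℕ) ^ 2 ≤ (2 * K) ^ 2 := by
    gcongr
    linarith
  rw [Real.sq_sqrt (Nat.cast_nonneg _)] at h2
  push_cast at h2
  linarith

theorem exists_density_le_natCast {P : Set (ℕ × ℕ)} (h : density P < ⊤) :
    ∃ k : ℕ, density P ≤ (k : ℝ≥0∞) :=
  (ENNReal.exists_nat_gt h.ne).imp fun _ => le_of_lt

end SchurPattern

/-! ### The theorem -/

theorem theorem2p3 (P : Set (ℕ × ℕ)) :
    List.TFAE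
      [SchurPattern.SchurBounded P,
        ∃ Pr Pc : Set (ℕ × ℕ),
          SchurPattern.RowFinite Pr ∧ SchurPattern.ColumnFinite Pc ∧ P = Pr ∪ Pc,
        SchurPattern.density P < ⊤] ∧
    (SchurPattern.density P < ⊤ →
      ∃ m : ℕ,
        IsLeast {k : ℕ | ∃ Pr Pc : Set (ℕ × ℕ),
          SchurPattern.RowBounded Pr k ∧ SchurPattern.ColumnBounded Pc k ∧ P = Pr ∪ Pc} m ∧
        IsLeast {k : ℕ | SchurPattern.density P ≤ (k : ℝ≥0∞)} m ∧
        ENNReal.ofReal (Real.sqrt m / 4) ≤ SchurPattern.schurBound P ∧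
        SchurPattern.schurBound P ≤ ENNReal.ofReal (2 * Real.sqrt m)) := by
  classical
  constructor
  · tfae_have 1 → 3 := SchurPattern.SchurBounded.density_lt_top
    tfae_have 3 → 2 := by
      intro h
      obtain ⟨k, hk⟩ := SchurPattern.exists_density_le_natCast h
      obtain ⟨Pr, Pc, hr, hc, hP⟩ := (SchurPattern.exists_decomposition_iff_density_le P k).2 hk
      exact ⟨Pr, Pc, ⟨k, hr⟩, ⟨k, hc⟩, hP⟩
    tfae_have 2 → 1 := by
      rintro ⟨Pr, Pc, ⟨k, hr⟩, ⟨l, hc⟩, rfl⟩ X hX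
      obtain ⟨Φ, hΦ, -⟩ := SchurPattern.exists_isSchurMultiplier_of_union hr hc hX
      exact ⟨Φ, hΦ⟩
    tfae_finish
  · intro h
    have hex := SchurPattern.exists_density_le_natCast h
    have hleast : IsLeast {k : ℕ | SchurPattern.density P ≤ (k : ℝ≥0∞)} (Nat.find hex) :=
      ⟨Nat.find_spec hex, fun k hk => Nat.find_min' hex hk⟩
    refine ⟨Nat.find hex, ?_, hleast, ?_, ?_⟩
    · simpa only [SchurPattern.exists_decomposition_iff_density_le] using hleast
    -- For `m = 0` the lower bound is trivial; for `m = k + 1`, minimality says that the density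
    -- exceeds `k`, which gives `√m / 2`.
    · rcases hm : Nat.find hex with _ | k
      · simp
      · have hk : ¬SchurPattern.density P ≤ (k : ℝ≥0∞) := Nat.find_min hex (by omega)
        refine le_trans (ENNReal.ofReal_le_ofReal ?_) (SchurPattern.schurBound_ge hk)
        have := Real.sqrt_nonneg ((k + 1 : ℕ) : ℝ)
        linarith
    · obtain ⟨Pr, Pc, hr, hc, hP⟩ :=
        (SchurPattern.exists_decomposition_iff_density_le P _).2 hleast.1
      conv_lhs => rw [hP]
      exact SchurPattern.schurBound_union_le hr hc
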